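/- For graphs $G_1,\dots,G_t$, let the multicolor Ramsey number $R(G_1,\dots,G_t)$ be the smallest positive integer $N$ such that whenever the edges of the complete graph $K_N$ are partitioned into $t$ disjoint (possibly empty) color classes giving $t$ graphs $H_1,\dots,H_t$, at least one $H_i$ has a subgraph isomorphic to $G_i$. Let $P_k$ denote the path on $k$ vertices. Then for all integers $m\ge n\ge 8$, $$R(P_3,P_n,P_m)=m+\left\lfloor \tfrac{n}{2}\right\rfloor-1 .$$ -/

import Mathlib

open SimpleGraph

/-- `N` has the Ramsey property for the graphs `G 0, …, G (t - 1)`: however the edges of the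
complete graph `K_N` are partitioned into `t` color classes, for some color `i` the graph formed
by the edges of color `i` has a subgraph isomorphic to `G i`. -/
def RamseyProperty {t : ℕ} {V : Fin t → Type} (G : ∀ i, SimpleGraph (V i)) (N : ℕ) : Prop :=
  ∀ C : TopEdgeLabeling (Fin N) (Fin t), ∃ i, (G i).IsContained (C.labelGraph i)

/-- `R` is the multicolor Ramsey number `R(G 0, …, G (t - 1))`: the smallest positive integer with
the Ramsey property for these graphs. -/
def IsRamseyNumber {t : ℕ} {V : Fin t → Type} (G : ∀ i, SimpleGraph (V i)) (R : ℕ) : Prop :=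
  IsLeast {N : ℕ | 0 < N ∧ RamseyProperty G N} R

/-- The family of paths `P_{k 0}, …, P_{k (t - 1)}`, where `P_j` is the path on `j` vertices. -/
def pathFamily {t : ℕ} (k : Fin t → ℕ) : ∀ i, SimpleGraph (Fin (k i)) :=
  fun i => pathGraph (k i)

/-!
The lower bound comes from `K_N` with `N = m + ⌊n / 2⌋ - 2` or fewer vertices in which a clique on
`m - 1` vertices has colour `2` and all other edges have colour `1`: a path of colour `1` uses a
vertex outside the clique in every pair of consecutive vertices, and there are only `⌊n / 2⌋ - 1`
of them.

For the upper bound, colour `0` is a matching `M`; write `R` and `B` for the other two colours.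
Let `u, x₂, …, x_{p-1}, v` be a longest `R`-path and let `T` be a set of `t` vertices outside it. A
vertex of `T` is not `R`-adjacent to `u` or `v`, and not `R`-adjacent to two consecutive vertices of
the path, since otherwise the path could be lengthened. Hence, up to `M`-edges, `u` and `v` are
`B`-adjacent to all of `T`, and each vertex of `T` is `B`-adjacent to one of the two vertices of
every *window*, that is, every pair of consecutive interior vertices of the path.

Start with `T` as a `B`-linear forest of `t` isolated vertices. As long as three components have
ends that are not `M`-adjacent to a given window, two of these ends have, by pigeonhole, a common
`B`-neighbour in the window, and the two components are joined through it (`BlueForest.merge`).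
A window is incident with at most two `M`-edges, so this works for any window while there are at
least five components, and for a well-chosen window when there are four. The last three components
are joined through `u` and `v`, in an order and direction for which no `M`-edge interferes
(`BlueForest.exists_spanning_segment`), and the two ends of the resulting path are lengthened
through two further windows. Counting the available windows gives a `B`-path on `2t` vertices if
`p ≥ 2t - 1`, and on `2t + 1` vertices if `p ≥ 2t` (`IsLongestPath.hasPath_two_mul`,
`IsLongestPath.hasPath_two_mul_add_one`).

With `t = ⌊n / 2⌋` this settles the case in which the longest `R`-path or the longest `B`-path has
at least `n - 1` vertices. If both are shorter, the same statement applied to the colour with the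
longer path, with `t` about half its length, produces in the other colour a still longer path;
paths with at most six vertices are treated separately, where many vertices remain outside
(`card_lt_of_longest`).
-/

/-! ### Paths as lists -/

/-- `G` has a path on exactly `k` vertices, given as a duplicate-free list of vertices in which
neighbouring entries are adjacent. -/
def HasPath {V : Type*} (G : SimpleGraph V) (k : ℕ) : Prop :=
  ∃ l : List V, l.Nodup ∧ l.IsChain G.Adj ∧ l.length = k

lemma HasPath.mono {V : Type*} {G : SimpleGraph V} {j k : ℕ} (h : HasPath G k) (hjk : j ≤ k) :
    HasPath G j := by
  obtain ⟨l, hn, hc, hl⟩ := h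
  exact ⟨l.take j, hn.sublist (List.take_sublist _ _), hc.take j, by simp; omega⟩

lemma HasPath.le_card {V : Type*} [Fintype V] {G : SimpleGraph V} {k : ℕ} (h : HasPath G k) :
    k ≤ Fintype.card V := by
  obtain ⟨l, hn, -, rfl⟩ := h
  exact hn.length_le_card

lemma HasPath.pathGraph_isContained {V : Type*} {G : SimpleGraph V} {k : ℕ} (h : HasPath G k) :
    (pathGraph k).IsContained G := by
  obtain ⟨l, hn, hc, rfl⟩ := h
  have hadj : ∀ i j : Fin l.length, i.val + 1 = j.val → G.Adj (l.get i) (l.get j) := by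
    rintro ⟨i, hi⟩ ⟨j, hj⟩ hij
    obtain rfl : i + 1 = j := hij
    exact hc.getElem i hj
  refine ⟨⟨⟨l.get, ?_⟩, List.nodup_iff_injective_get.1 hn⟩⟩
  intro i j hij
  rcases pathGraph_adj.1 hij with h | h
  · exact hadj i j h
  · exact (hadj j i h).symm

/-- Every graph on a finite vertex type has a longest path. -/
lemma exists_longest_path {V : Type*} [Fintype V] (G : SimpleGraph V) :
    ∃ p, HasPath G p ∧ ∀ k, HasPath G k → k ≤ p := by
  classical
  have h0 : HasPath G 0 := ⟨[], by simp, by simp, rfl⟩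
  refine ⟨Nat.findGreatest (HasPath G) (Fintype.card V), Nat.findGreatest_spec (Nat.zero_le _) h0,
    fun k hk => Nat.le_findGreatest hk.le_card hk⟩

/-! ### The lower bound -/

/-- The three-colouring of `K_N` without colour `0` in which an edge has colour `2` exactly when
both ends are smaller than `a`. -/
def cliqueColoring (N a : ℕ) : TopEdgeLabeling (Fin N) (Fin 3) :=
  EdgeLabeling.mk (fun x y _ => if x.val < a ∧ y.val < a then 2 else 1)
    (by intro x y _; simp [and_comm])

lemma cliqueColoring_get {N a : ℕ} {x y : Fin N} (h : x ≠ y) :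
    (cliqueColoring N a).get x y h = if x.val < a ∧ y.val < a then 2 else 1 := rfl

lemma not_ramseyProperty_paths {m n N : ℕ} (hn : 2 ≤ n) (hmn : n ≤ m) (hN : N < m + n / 2 - 1) :
    ¬ RamseyProperty (pathFamily ![3, n, m]) N := by
  intro h
  obtain ⟨i, ⟨f⟩⟩ := h (cliqueColoring N (m - 1))
  fin_cases i
  · have h01 : (pathGraph 3).Adj 0 1 := by simp [pathGraph_adj]
    replace f : Copy (pathGraph 3) ((cliqueColoring N (m - 1)).labelGraph 0) := f
    have := f.toHom.map_adj h01
    obtain ⟨hne, hc⟩ := (TopEdgeLabeling.labelGraph_adj _ _).1 this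
    rw [cliqueColoring_get] at hc
    split_ifs at hc <;> simp at hc
  · -- Of two consecutive vertices of a path of colour `1`, at least one lies outside the clique.
    replace f : Copy (pathGraph n) ((cliqueColoring N (m - 1)).labelGraph 1) := f
    have key : ∀ i j : Fin n, i.val + 1 = j.val → m - 1 ≤ (f i).val ∨ m - 1 ≤ (f j).val := by
      intro i j hij
      have := f.toHom.map_adj (pathGraph_adj.2 (Or.inl hij))
      obtain ⟨hne, hc⟩ := (TopEdgeLabeling.labelGraph_adj _ _).1 this
      rw [cliqueColoring_get] at hc
      by_contra! hcon
      rw [if_pos (by exact hcon)] at hc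
      simp at hc
    have hch : ∀ s : Fin (n / 2), ∃ j : Fin n, j.val / 2 = s.val ∧ m - 1 ≤ (f j).val := by
      intro s
      rcases key ⟨2 * s, by omega⟩ ⟨2 * s + 1, by omega⟩ rfl with h | h
      · exact ⟨_, by simp, h⟩
      · exact ⟨_, by simp; omega, h⟩
    choose g hg hgm using hch
    have hinj : Function.Injective
        (fun s => (⟨(f (g s)).val - (m - 1), by have := hgm s; omega⟩ : Fin (n / 2 - 1))) := by
      intro s s' hss
      have h1 := hgm s
      have h2 := hgm s'
      simp only [Fin.mk.injEq] at hss
      have h3 : f (g s) = f (g s') := Fin.ext (by omega)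
      have h4 := f.injective h3
      exact Fin.ext (by rw [← hg s, ← hg s', h4])
    have := Fintype.card_le_of_injective _ hinj
    simp at this
    omega
  · replace f : Copy (pathGraph m) ((cliqueColoring N (m - 1)).labelGraph 2) := f
    have key : ∀ i j : Fin m, (pathGraph m).Adj i j → (f i).val < m - 1 := by
      intro i j hij
      have := f.toHom.map_adj hij
      obtain ⟨hne, hc⟩ := (TopEdgeLabeling.labelGraph_adj _ _).1 this
      rw [cliqueColoring_get] at hc
      split_ifs at hc with hlt
      · exact hlt.1
      · simp at hc
    have key' : ∀ i : Fin m, (f i).val < m - 1 := by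
      intro i
      by_cases hi : i.val + 1 < m
      · exact key i ⟨i + 1, hi⟩ (pathGraph_adj.2 (Or.inl rfl))
      · exact key i ⟨i - 1, by omega⟩ (pathGraph_adj.2 (Or.inr (by simp; omega)))
    have hinj : Function.Injective (fun i => (⟨(f i).val, key' i⟩ : Fin (m - 1))) := by
      intro i j hij
      simp only [Fin.mk.injEq] at hij
      exact f.injective (Fin.ext hij)
    have := Fintype.card_le_of_injective _ hinj
    simp at this
    omega

/-! ### Segments -/

/-- A `B`-path, written as a list, whose two end vertices lie in `Y`. -/
structure IsSegment {V : Type*} (B : SimpleGraph V) (Y : Set V) (C : List V) : Prop where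
  chain : C.IsChain B.Adj
  head : ∃ e ∈ Y, C.head? = some e
  last : ∃ e ∈ Y, C.getLast? = some e

section Segments

variable {V : Type*} {B : SimpleGraph V} {Y : Set V} {C D : List V}

lemma IsSegment.reverse (h : IsSegment B Y C) : IsSegment B Y C.reverse where
  chain := List.isChain_reverse.2 (h.chain.imp fun _ _ hab => hab.symm)
  head := by simpa using h.last
  last := by simpa using h.head

lemma isSegment_singleton {y : V} (hy : y ∈ Y) : IsSegment B Y [y] :=
  ⟨by simp, ⟨y, hy, rfl⟩, ⟨y, hy, rfl⟩⟩

lemma IsSegment.join {e f x : V} (hC : IsSegment B Y C) (hD : IsSegment B Y D)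
    (he : C.getLast? = some e) (hf : D.head? = some f) (hex : B.Adj e x) (hfx : B.Adj f x) :
    IsSegment B Y (C ++ x :: D) where
  chain := by
    rw [List.isChain_append]
    refine ⟨hC.chain, hD.chain.cons fun y hy => ?_, fun a ha b hb => ?_⟩
    · simp only [hf, Option.mem_some_iff] at hy
      exact hy ▸ hfx.symm
    · simp only [he, Option.mem_some_iff, List.head?_cons] at ha hb
      exact ha ▸ hb ▸ hex
  head := by
    obtain ⟨a, ha, h⟩ := hC.head
    exact ⟨a, ha, by simp [h]⟩
  last := by
    obtain ⟨a, ha, h⟩ := hD.last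
    refine ⟨a, ha, ?_⟩
    cases D with
    | nil => simp at h
    | cons d D => simpa using h

lemma IsSegment.ne_nil (h : IsSegment B Y C) : C ≠ [] := by
  rintro rfl
  obtain ⟨e, -, he⟩ := h.head
  simp at he

lemma eq_singleton_of_head?_eq_getLast? {e : V} (hn : C.Nodup) (h1 : C.head? = some e)
    (h2 : C.getLast? = some e) : C = [e] := by
  cases C with
  | nil => simp at h1
  | cons a C =>
    simp only [List.head?_cons, Option.some.injEq] at h1
    subst h1
    cases C with
    | nil => rfl
    | cons b C =>
      rw [List.getLast?_cons_cons] at h2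
      exact absurd (List.mem_of_getLast? h2) (List.nodup_cons.1 hn).1

end Segments

/-! ### Linear forests and windows -/

/-- The vertices of a list of pairs, in order. -/
def pairVertices {V : Type*} (ws : List (V × V)) : List V :=
  ws.flatMap fun w => [w.1, w.2]

/-- A `B`-linear forest `L` whose components have their ends in `Y`, together with a supply of
unused vertices: the windows `ws` and the two connectors `u`, `v`. Every `y ∈ Y` is `B`-adjacent to
a vertex of each window, unless it is `M`-adjacent to one. The field `count` records the number of
vertices, `2t - L.length`: that is what remains true when `t` isolated vertices are joined, each
join adding one vertex and removing one component. -/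
structure BlueForest {V : Type*} (B M : SimpleGraph V) (Y : Set V) (u v : V) (t : ℕ)
    (L : List (List V)) (ws : List (V × V)) : Prop where
  segment : ∀ C ∈ L, IsSegment B Y C
  nodup : (L.flatten ++ pairVertices ws ++ [u, v]).Nodup
  window : ∀ w ∈ ws, ∀ y ∈ Y, B.Adj y w.1 ∨ B.Adj y w.2 ∨ M.Adj w.1 y ∨ M.Adj w.2 y
  count : L.flatten.length + L.length = 2 * t

section Forests

variable {V : Type*} {B M : SimpleGraph V} {Y : Set V} {u v : V} {t : ℕ}
  {L L' : List (List V)} {ws ws' : List (V × V)}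

lemma pairVertices_cons (w : V × V) (ws : List (V × V)) :
    pairVertices (w :: ws) = w.1 :: w.2 :: pairVertices ws := rfl

lemma length_pairVertices (ws : List (V × V)) : (pairVertices ws).length = 2 * ws.length := by
  induction ws with
  | nil => rfl
  | cons w ws ih => rw [pairVertices_cons]; simp [ih]; ring

lemma BlueForest.perm (h : BlueForest B M Y u v t L ws) (hL : L.Perm L') (hw : ws.Perm ws') :
    BlueForest B M Y u v t L' ws' where
  segment C hC := h.segment C (hL.mem_iff.2 hC)
  nodup := (((hL.flatten.append (hw.flatMap_right _)).append_right _).nodup_iff).1 h.nodup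
  window w hw' := h.window w (hw.mem_iff.2 hw')
  count := by rw [← hL.flatten.length_eq, ← hL.length_eq, h.count]

/-- Two components of a linear forest are joined through a vertex `z` of a window. -/
lemma BlueForest.join {C₁ C₂ D₁ D₂ : List V} {w : V × V} {e₁ e₂ z : V}
    (h : BlueForest B M Y u v t (C₁ :: C₂ :: L) (w :: ws))
    (hD₁ : IsSegment B Y D₁) (hD₂ : IsSegment B Y D₂) (hp₁ : D₁.Perm C₁) (hp₂ : D₂.Perm C₂)
    (he₁ : D₁.head? = some e₁) (he₂ : D₂.head? = some e₂) (h₁ : B.Adj e₁ z) (h₂ : B.Adj e₂ z)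
    (hz : z = w.1 ∨ z = w.2) :
    BlueForest B M Y u v t ((D₁.reverse ++ z :: D₂) :: L) ws where
  segment C hC := by
    rcases List.mem_cons.1 hC with rfl | hC
    · exact hD₁.reverse.join hD₂ (by simpa using he₁) he₂ h₁ h₂
    · exact h.segment C (by simp [hC])
  nodup := by
    classical
    have h0 := h.nodup
    rw [List.nodup_iff_count_le_one] at h0 ⊢
    intro a
    have := h0 a
    have e1 := hp₁.count_eq a
    have e2 := hp₂.count_eq a
    rw [pairVertices_cons] at this
    simp only [List.flatten_cons, List.count_append, List.count_cons, List.count_reverse] at this ⊢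
    rcases hz with rfl | rfl <;> omega
  window w' hw' := h.window w' (by simp [hw'])
  count := by
    have := h.count
    have e1 := hp₁.length_eq
    have e2 := hp₂.length_eq
    simp at this ⊢
    omega

/-- Both ends of the component `C` are `M`-adjacent to the window `w`. -/
def IsBlocked (M : SimpleGraph V) (w : V × V) (C : List V) : Prop :=
  (∀ e, C.head? = some e → M.Adj w.1 e ∨ M.Adj w.2 e) ∧
    ∀ e, C.getLast? = some e → M.Adj w.1 e ∨ M.Adj w.2 e

lemma exists_orientation_of_not_isBlocked {w : V × V} {C : List V} (hC : IsSegment B Y C)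
    (hw : ∀ y ∈ Y, B.Adj y w.1 ∨ B.Adj y w.2 ∨ M.Adj w.1 y ∨ M.Adj w.2 y)
    (h : ¬ IsBlocked M w C) :
    ∃ D e, IsSegment B Y D ∧ D.Perm C ∧ D.head? = some e ∧ (B.Adj e w.1 ∨ B.Adj e w.2) := by
  rw [IsBlocked, not_and_or] at h
  rcases h with h | h
  · obtain ⟨e, he, hm⟩ := by push Not at h; exact h
    obtain ⟨e', he', h'⟩ := hC.head
    obtain rfl : e' = e := by simpa [h'] using he
    have := hw e' he'
    exact ⟨C, e', hC, List.Perm.refl _, h', by tauto⟩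
  · obtain ⟨e, he, hm⟩ := by push Not at h; exact h
    obtain ⟨e', he', h'⟩ := hC.last
    obtain rfl : e' = e := by simpa [h'] using he
    have := hw e' he'
    exact ⟨C.reverse, e', hC.reverse, List.reverse_perm _, by simpa using h', by tauto⟩

/-- Pigeonhole step: among three components that are not blocked for a window, two have ends
adjacent to the same vertex of the window. -/
lemma BlueForest.merge {C₁ C₂ C₃ : List V} {w : V × V}
    (h : BlueForest B M Y u v t (C₁ :: C₂ :: C₃ :: L) (w :: ws))
    (h₁ : ¬ IsBlocked M w C₁) (h₂ : ¬ IsBlocked M w C₂) (h₃ : ¬ IsBlocked M w C₃) :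
    ∃ L', BlueForest B M Y u v t L' ws ∧ L'.length = L.length + 2 := by
  have hw := h.window w (by simp)
  obtain ⟨D₁, e₁, s₁, p₁, q₁, b₁⟩ :=
    exists_orientation_of_not_isBlocked (h.segment C₁ (by simp)) hw h₁
  obtain ⟨D₂, e₂, s₂, p₂, q₂, b₂⟩ :=
    exists_orientation_of_not_isBlocked (h.segment C₂ (by simp)) hw h₂
  obtain ⟨D₃, e₃, s₃, p₃, q₃, b₃⟩ :=
    exists_orientation_of_not_isBlocked (h.segment C₃ (by simp)) hw h₃
  have h12 : ∀ z, (z = w.1 ∨ z = w.2) → B.Adj e₁ z → B.Adj e₂ z →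
      ∃ L', BlueForest B M Y u v t L' ws ∧ L'.length = L.length + 2 := fun z hz a b =>
    ⟨_, h.join s₁ s₂ p₁ p₂ q₁ q₂ a b hz, by simp⟩
  have h13 : ∀ z, (z = w.1 ∨ z = w.2) → B.Adj e₁ z → B.Adj e₃ z →
      ∃ L', BlueForest B M Y u v t L' ws ∧ L'.length = L.length + 2 := fun z hz a b =>
    ⟨_, (h.perm ((List.Perm.swap _ _ _).cons _) (List.Perm.refl _)).join s₁ s₃ p₁ p₃ q₁ q₃ a b hz,
      by simp⟩
  have h23 : ∀ z, (z = w.1 ∨ z = w.2) → B.Adj e₂ z → B.Adj e₃ z →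
      ∃ L', BlueForest B M Y u v t L' ws ∧ L'.length = L.length + 2 := fun z hz a b =>
    ⟨_, (h.perm ((List.Perm.swap _ _ _).trans ((List.Perm.swap _ _ _).cons _))
      (List.Perm.refl _)).join s₂ s₃ p₂ p₃ q₂ q₃ a b hz, by simp⟩
  rcases b₁ with b₁ | b₁ <;> rcases b₂ with b₂ | b₂ <;> rcases b₃ with b₃ | b₃
  · exact h12 _ (Or.inl rfl) b₁ b₂
  · exact h12 _ (Or.inl rfl) b₁ b₂
  · exact h13 _ (Or.inl rfl) b₁ b₃
  · exact h23 _ (Or.inr rfl) b₂ b₃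
  · exact h23 _ (Or.inl rfl) b₂ b₃
  · exact h13 _ (Or.inr rfl) b₁ b₃
  · exact h12 _ (Or.inr rfl) b₁ b₂
  · exact h12 _ (Or.inr rfl) b₁ b₂

lemma BlueForest.merge_of_blocked_length_le (h : BlueForest B M Y u v t L (w :: ws))
    [DecidablePred (IsBlocked M w)]
    (hb : (L.filter (IsBlocked M w)).length + 3 ≤ L.length) :
    ∃ L', BlueForest B M Y u v t L' ws ∧ L'.length + 1 = L.length := by
  have hp := List.filter_append_perm (fun C => decide (IsBlocked M w C)) L
  have hl := hp.length_eq
  have hmem : ∀ C ∈ L.filter (fun C => !decide (IsBlocked M w C)), ¬ IsBlocked M w C := by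
    intro C hC
    simpa using (List.mem_filter.1 hC).2
  rw [List.length_append] at hl
  generalize L.filter (fun C => !decide (IsBlocked M w C)) = G at hp hl hmem
  match G, hp, hl, hmem with
  | [], _, hl, _ => simp only [List.length_nil] at hl; omega
  | [_], _, hl, _ => simp only [List.length_cons, List.length_nil] at hl; omega
  | [_, _], _, hl, _ => simp only [List.length_cons, List.length_nil] at hl; omega
  | C₁ :: C₂ :: C₃ :: G, hp, hl, hmem =>
    have h' := h.perm (hp.symm.trans List.perm_append_comm) (List.Perm.refl _)
    obtain ⟨L', hL', hlen⟩ := BlueForest.merge (L := G ++ L.filter (IsBlocked M w)) h'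
      (hmem _ (by simp)) (hmem _ (by simp)) (hmem _ (by simp))
    refine ⟨L', hL', ?_⟩
    simp only [List.length_append, List.length_cons] at hlen hl ⊢
    omega

/-- Distinct components have distinct vertices. -/
lemma BlueForest.ne_of_mem {C₁ C₂ : List V} {a b : V}
    (h : BlueForest B M Y u v t (C₁ :: C₂ :: L) ws) (ha : a ∈ C₁) (hb : b ∈ C₂) : a ≠ b := by
  rintro rfl
  have := (List.nodup_append.1 (List.nodup_append.1 h.nodup).1).1
  simp only [List.flatten_cons] at this
  exact (List.nodup_append.1 this).2.2 a ha a (by simp [hb]) rfl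

lemma BlueForest.nodup_of_mem {C : List V} (h : BlueForest B M Y u v t L ws) (hC : C ∈ L) :
    C.Nodup :=
  (List.nodup_flatten.1 (List.nodup_append.1 (List.nodup_append.1 h.nodup).1).1).1 C hC

end Forests

/-! ### Reduction to three components -/

section Reduction

variable {V : Type*} {B M : SimpleGraph V} {Y : Set V} {u v : V} {t : ℕ}
  {L : List (List V)} {ws : List (V × V)}

/-- If `M` is a matching, a window blocks at most two components. -/
lemma BlueForest.blocked_length_le_two (hM : ∀ x y z, M.Adj x y → M.Adj x z → y = z)
    (h : BlueForest B M Y u v t L ws) (w : V × V) [DecidablePred (IsBlocked M w)] :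
    (L.filter (IsBlocked M w)).length ≤ 2 := by
  by_contra! hcon
  have hp := List.filter_append_perm (fun C => decide (IsBlocked M w C)) L
  have hmem : ∀ C ∈ L.filter (IsBlocked M w), IsBlocked M w C := by
    intro C hC
    simpa using (List.mem_filter.1 hC).2
  generalize L.filter (fun C => decide (IsBlocked M w C)) = G at hp hcon hmem
  match G, hp, hcon, hmem with
  | C₁ :: C₂ :: C₃ :: G, hp, _, hmem =>
    have h' := h.perm hp.symm (List.Perm.refl _)
    obtain ⟨e₁, -, q₁⟩ := (h'.segment C₁ (by simp)).head
    obtain ⟨e₂, -, q₂⟩ := (h'.segment C₂ (by simp)).head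
    obtain ⟨e₃, -, q₃⟩ := (h'.segment C₃ (by simp)).head
    have m₁ := List.mem_of_head? q₁
    have m₂ := List.mem_of_head? q₂
    have m₃ := List.mem_of_head? q₃
    have h12 := h'.ne_of_mem m₁ m₂
    have h13 := (h'.perm ((List.Perm.swap _ _ _).cons _) (List.Perm.refl _)).ne_of_mem m₁ m₃
    have h23 := (h'.perm ((List.Perm.swap _ _ _).trans ((List.Perm.swap _ _ _).cons _))
      (List.Perm.refl _)).ne_of_mem m₂ m₃
    rcases (hmem C₁ (by simp)).1 _ q₁ with b₁ | b₁ <;>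
    rcases (hmem C₂ (by simp)).1 _ q₂ with b₂ | b₂ <;>
    rcases (hmem C₃ (by simp)).1 _ q₃ with b₃ | b₃
    · exact h12 (hM _ _ _ b₁ b₂)
    · exact h12 (hM _ _ _ b₁ b₂)
    · exact h13 (hM _ _ _ b₁ b₃)
    · exact h23 (hM _ _ _ b₂ b₃)
    · exact h23 (hM _ _ _ b₂ b₃)
    · exact h13 (hM _ _ _ b₁ b₃)
    · exact h12 (hM _ _ _ b₁ b₂)
    · exact h12 (hM _ _ _ b₁ b₂)

/-- Both vertices of the window `w` are `M`-adjacent to one-vertex components of `L`. -/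
def BlocksTwo (M : SimpleGraph V) (L : List (List V)) (w : V × V) : Prop :=
  ∃ e f, [e] ∈ L ∧ [f] ∈ L ∧ M.Adj w.1 e ∧ M.Adj w.2 f

/-- Two components blocked by the same window use up both `M`-edges at the window, so each of them
has a single vertex as its two ends. -/
lemma BlueForest.blocked_length_le_one (hM : ∀ x y z, M.Adj x y → M.Adj x z → y = z)
    (h : BlueForest B M Y u v t L ws) (w : V × V) [DecidablePred (IsBlocked M w)]
    (hw : ¬ BlocksTwo M L w) :
    (L.filter (IsBlocked M w)).length ≤ 1 := by
  by_contra! hcon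
  apply hw
  have hp := List.filter_append_perm (fun C => decide (IsBlocked M w C)) L
  have hmem : ∀ C ∈ L.filter (IsBlocked M w), IsBlocked M w C := by
    intro C hC
    simpa using (List.mem_filter.1 hC).2
  generalize L.filter (fun C => decide (IsBlocked M w C)) = G at hp hcon hmem
  match G, hp, hcon, hmem with
  | C₁ :: C₂ :: G, hp, _, hmem =>
    have h' := h.perm hp.symm (List.Perm.refl _)
    obtain ⟨e₁, -, q₁⟩ := (h'.segment C₁ (by simp)).head
    obtain ⟨e₂, -, q₂⟩ := (h'.segment C₂ (by simp)).head
    obtain ⟨f₁, -, r₁⟩ := (h'.segment C₁ (by simp)).last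
    obtain ⟨f₂, -, r₂⟩ := (h'.segment C₂ (by simp)).last
    have hee := h'.ne_of_mem (List.mem_of_head? q₁) (List.mem_of_head? q₂)
    have hef := h'.ne_of_mem (List.mem_of_head? q₁) (List.mem_of_getLast? r₂)
    have hfe := h'.ne_of_mem (List.mem_of_getLast? r₁) (List.mem_of_head? q₂)
    have key : f₁ = e₁ → f₂ = e₂ → [e₁] ∈ L ∧ [e₂] ∈ L := by
      rintro rfl rfl
      rw [← eq_singleton_of_head?_eq_getLast? (h'.nodup_of_mem (by simp)) q₁ r₁,
        ← eq_singleton_of_head?_eq_getLast? (h'.nodup_of_mem (by simp)) q₂ r₂]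
      exact ⟨hp.subset (by simp), hp.subset (by simp)⟩
    have b₁ := (hmem C₁ (by simp)).1 _ q₁
    have b₂ := (hmem C₂ (by simp)).1 _ q₂
    have c₁ := (hmem C₁ (by simp)).2 _ r₁
    have c₂ := (hmem C₂ (by simp)).2 _ r₂
    rcases b₁ with b₁ | b₁ <;> rcases b₂ with b₂ | b₂
    · exact absurd (hM _ _ _ b₁ b₂) hee
    · have k₁ : f₁ = e₁ := c₁.elim (fun c => hM _ _ _ c b₁) fun c => absurd (hM _ _ _ c b₂) hfe
      have k₂ : f₂ = e₂ := c₂.elim (fun c => absurd (hM _ _ _ b₁ c) hef) fun c => hM _ _ _ c b₂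
      exact ⟨e₁, e₂, (key k₁ k₂).1, (key k₁ k₂).2, b₁, b₂⟩
    · have k₁ : f₁ = e₁ := c₁.elim (fun c => absurd (hM _ _ _ c b₂) hfe) fun c => hM _ _ _ c b₁
      have k₂ : f₂ = e₂ := c₂.elim (fun c => hM _ _ _ c b₂) fun c => absurd (hM _ _ _ b₁ c) hef
      exact ⟨e₂, e₁, (key k₁ k₂).2, (key k₁ k₂).1, b₂, b₁⟩
    · exact absurd (hM _ _ _ b₁ b₂) hee

lemma BlueForest.merge_of_five_le (hM : ∀ x y z, M.Adj x y → M.Adj x z → y = z) {w : V × V}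
    (h : BlueForest B M Y u v t L (w :: ws)) (hL : 5 ≤ L.length) :
    ∃ L', BlueForest B M Y u v t L' ws ∧ L'.length + 1 = L.length := by
  classical
  exact h.merge_of_blocked_length_le (by have := h.blocked_length_le_two hM w; omega)

lemma BlueForest.merge_of_four (hM : ∀ x y z, M.Adj x y → M.Adj x z → y = z)
    (h : BlueForest B M Y u v t L ws) (hL : L.length = 4) (hw : ∃ w ∈ ws, ¬ BlocksTwo M L w) :
    ∃ L' ws', BlueForest B M Y u v t L' ws' ∧ L'.length = 3 ∧ ws'.length + 1 = ws.length := by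
  classical
  obtain ⟨w, hw, hb⟩ := hw
  have hp := List.perm_cons_erase hw
  have h' := h.perm (List.Perm.refl _) hp
  obtain ⟨L', hL', hlen⟩ := h'.merge_of_blocked_length_le
    (by have := h'.blocked_length_le_one hM w hb; omega)
  exact ⟨L', _, hL', by omega, by have := hp.length_eq; simp at this; omega⟩

/-- Two windows cannot both block two one-vertex components of a four-component forest that has a
larger component. -/
lemma BlueForest.exists_not_blocksTwo (hM : ∀ x y z, M.Adj x y → M.Adj x z → y = z)
    (h : BlueForest B M Y u v t L ws) (hL : L.length = 4) (ht : 5 ≤ t) (hw : 2 ≤ ws.length) :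
    ∃ w ∈ ws, ¬ BlocksTwo M L w := by
  classical
  by_contra! hcon
  obtain ⟨C₀, hC₀, hlen⟩ : ∃ C ∈ L, 2 ≤ C.length := by
    by_contra! hs
    have h1 : L.flatten.length ≤ L.length := by
      rw [List.length_flatten]
      refine (List.sum_le_card_nsmul _ 1 ?_).trans (by simp)
      intro x hx
      obtain ⟨C, hC, rfl⟩ := List.mem_map.1 hx
      have := hs C hC
      omega
    have := h.count
    omega
  match ws, h, hw, hcon with
  | w :: w' :: ws, h, _, hcon =>
    obtain ⟨a, b, ha, hb, haM, hbM⟩ := hcon w (by simp)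
    obtain ⟨c, d, hc, hd, hcM, hdM⟩ := hcon w' (by simp)
    have hnd : (w.1 :: w.2 :: w'.1 :: w'.2 :: pairVertices ws).Nodup :=
      (List.nodup_append.1 (List.nodup_append.1 h.nodup).1).2.1
    have hMs : ∀ {x y z}, M.Adj x z → M.Adj y z → x = y := fun h₁ h₂ => hM _ _ _ h₁.symm h₂.symm
    simp only [List.nodup_cons, List.mem_cons, not_or] at hnd
    obtain ⟨⟨n12, n13, n14, -⟩, ⟨n23, n24, -⟩, ⟨n34, -⟩, -⟩ := hnd
    have hsub : ({[a], [b], [c], [d]} : Finset (List V)) ⊆ (L.erase C₀).toFinset := by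
      intro C hC
      simp only [Finset.mem_insert, Finset.mem_singleton] at hC
      rw [List.mem_toFinset]
      rcases hC with rfl | rfl | rfl | rfl
      all_goals
        refine (List.mem_erase_of_ne ?_).2 (by assumption)
        rintro rfl
        simp at hlen
    have hcard := Finset.card_le_card hsub
    have hab : a ≠ b := by rintro rfl; exact n12 (hMs haM hbM)
    have hac : a ≠ c := by rintro rfl; exact n13 (hMs haM hcM)
    have had : a ≠ d := by rintro rfl; exact n14 (hMs haM hdM)
    have hbc : b ≠ c := by rintro rfl; exact n23 (hMs hbM hcM)
    have hbd : b ≠ d := by rintro rfl; exact n24 (hMs hbM hdM)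
    have hcd : c ≠ d := by rintro rfl; exact n34 (hMs hcM hdM)
    rw [Finset.card_insert_of_notMem (by simp [hab, hac, had]),
      Finset.card_insert_of_notMem (by simp [hbc, hbd]),
      Finset.card_insert_of_notMem (by simp [hcd]), Finset.card_singleton] at hcard
    have := (L.erase C₀).toFinset_card_le
    rw [List.length_erase_of_mem hC₀] at this
    omega

/-- Merging through windows until three components are left. -/
lemma BlueForest.exists_three (hM : ∀ x y z, M.Adj x y → M.Adj x z → y = z) (ht : 5 ≤ t)
    {r : ℕ} (hr : 1 ≤ r) {k : ℕ} :
    ∀ {L : List (List V)} {ws : List (V × V)}, BlueForest B M Y u v t L ws → L.length = k + 3 →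
      ws.length = k + r →
      ∃ L' ws', BlueForest B M Y u v t L' ws' ∧ L'.length = 3 ∧ ws'.length = r := by
  induction k with
  | zero => exact fun h hL hw => ⟨_, _, h, by omega, by omega⟩
  | succ k ih =>
    intro L ws h hL hw
    rcases Nat.eq_zero_or_pos k with rfl | hk
    · obtain ⟨L', ws', h', hL', hw'⟩ := h.merge_of_four hM hL
        (h.exists_not_blocksTwo hM hL ht (by omega))
      exact ⟨L', ws', h', hL', by omega⟩
    · match ws, h, hw with
      | [], _, hw => simp at hw; omega
      | w :: ws, h, hw =>
        obtain ⟨L', h', hL'⟩ := h.merge_of_five_le hM (by omega)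
        exact ih h' (by omega) (by simp at hw; omega)

end Reduction

/-! ### Joining the last three components -/

section Orientation

variable {V : Type*} {B M : SimpleGraph V} {Y : Set V} {u v : V} {t : ℕ}
  {L : List (List V)} {ws : List (V × V)} {C : List V} {P Q : V → Prop}

/-- The segment `C` can be traversed in a direction that starts outside `P` and ends
outside `Q`. -/
def TraversableAvoiding (B : SimpleGraph V) (Y : Set V) (P Q : V → Prop) (C : List V) : Prop :=
  ∃ D e f, IsSegment B Y D ∧ D.Perm C ∧ D.head? = some e ∧ D.getLast? = some f ∧
    e ∈ Y ∧ f ∈ Y ∧ ¬ P e ∧ ¬ Q f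

/-- Both ends of `C` satisfy `P`. -/
def BothEnds (P : V → Prop) (C : List V) : Prop :=
  (∀ e, C.head? = some e → P e) ∧ ∀ e, C.getLast? = some e → P e

lemma traversableAvoiding_of_not_bothEnds (hC : IsSegment B Y C) (hPQ : ∀ y ∈ Y, P y → ¬ Q y)
    (hP : ¬ BothEnds P C) (hQ : ¬ BothEnds Q C) : TraversableAvoiding B Y P Q C := by
  obtain ⟨e, heY, he⟩ := hC.head
  obtain ⟨f, hfY, hf⟩ := hC.last
  have hP' : ¬ (P e ∧ P f) := fun h => hP
    ⟨fun a ha => by simp_all, fun a ha => by simp_all⟩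
  have hQ' : ¬ (Q e ∧ Q f) := fun h => hQ
    ⟨fun a ha => by simp_all, fun a ha => by simp_all⟩
  have := hPQ e heY
  have := hPQ f hfY
  by_cases h : ¬ P e ∧ ¬ Q f
  · exact ⟨C, e, f, hC, List.Perm.refl _, he, hf, heY, hfY, h.1, h.2⟩
  · refine ⟨C.reverse, f, e, hC.reverse, List.reverse_perm _, by simpa using hf,
      by simpa using he, hfY, heY, ?_, ?_⟩ <;> tauto

lemma BlueForest.not_bothEnds_of_subsingleton {C₁ C₂ : List V}
    (h : BlueForest B M Y u v t (C₁ :: C₂ :: L) ws) (hP : ∀ y z, P y → P z → y = z)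
    (h₁ : BothEnds P C₁) : ¬ BothEnds P C₂ := by
  intro h₂
  obtain ⟨e, -, he⟩ := (h.segment C₁ (by simp)).head
  obtain ⟨f, -, hf⟩ := (h.segment C₂ (by simp)).head
  exact h.ne_of_mem (List.mem_of_head? he) (List.mem_of_head? hf)
    (hP _ _ (h₁.1 _ he) (h₂.1 _ hf))

/-- A component with at least two vertices has two distinct ends. -/
lemma BlueForest.exists_ends_ne (h : BlueForest B M Y u v t L ws) (hC : C ∈ L)
    (hlen : 2 ≤ C.length) :
    ∃ e f, e ≠ f ∧ C.head? = some e ∧ C.getLast? = some f := by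
  obtain ⟨e, -, he⟩ := (h.segment C hC).head
  obtain ⟨f, -, hf⟩ := (h.segment C hC).last
  refine ⟨e, f, ?_, he, hf⟩
  rintro rfl
  rw [eq_singleton_of_head?_eq_getLast? (h.nodup_of_mem hC) he hf] at hlen
  simp at hlen

lemma BlueForest.not_bothEnds_of_two_le (h : BlueForest B M Y u v t L ws) (hC : C ∈ L)
    (hlen : 2 ≤ C.length) (hP : ∀ y z, P y → P z → y = z) : ¬ BothEnds P C := by
  intro hb
  obtain ⟨e, f, hef, he, hf⟩ := h.exists_ends_ne hC hlen
  exact hef (hP _ _ (hb.1 _ he) (hb.2 _ hf))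

/-- If `P` holds for at most two vertices and for both ends of a component with two distinct ends,
then no other component has an end in `P`. -/
lemma BlueForest.not_bothEnds_of_bothEnds {C' : List V}
    (h : BlueForest B M Y u v t (C :: C' :: L) ws)
    (hlen : 2 ≤ C.length) (hP : ∀ x y z, P x → P y → P z → x = y ∨ x = z ∨ y = z)
    (hb : BothEnds P C) : ¬ BothEnds P C' := by
  intro hb'
  obtain ⟨e, f, hef, he, hf⟩ := h.exists_ends_ne (by simp) hlen
  obtain ⟨g, -, hg⟩ := (h.segment C' (by simp)).head
  have h1 := h.ne_of_mem (List.mem_of_head? he) (List.mem_of_head? hg)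
  have h2 := h.ne_of_mem (List.mem_of_getLast? hf) (List.mem_of_head? hg)
  rcases hP e f g (hb.1 _ he) (hb.2 _ hf) (hb'.1 _ hg) with h | h | h <;> contradiction

lemma BothEnds.not_of_disjoint (hC : IsSegment B Y C) (hPQ : ∀ y ∈ Y, P y → ¬ Q y)
    (hP : BothEnds P C) : ¬ BothEnds Q C := by
  intro hQ
  obtain ⟨e, heY, he⟩ := hC.head
  exact hPQ e heY (hP.1 _ he) (hQ.1 _ he)

/-- Three components `C₁`, `C₂`, `C₃` are joined in this order through the connectors `x`, `x'`. -/
lemma BlueForest.join_three {C₁ C₂ C₃ : List V} {x x' : V} {A A' : V → Prop}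
    (h : BlueForest B M Y u v t [C₁, C₂, C₃] ws)
    (hx : ∀ y ∈ Y, B.Adj y x ∨ M.Adj x y) (hx' : ∀ y ∈ Y, B.Adj y x' ∨ M.Adj x' y)
    (hp : [x, x'].Perm [u, v])
    (h₁ : TraversableAvoiding B Y A (M.Adj x) C₁)
    (h₂ : TraversableAvoiding B Y (M.Adj x) (M.Adj x') C₂)
    (h₃ : TraversableAvoiding B Y (M.Adj x') A' C₃) :
    ∃ D e f, IsSegment B Y D ∧ D.head? = some e ∧ D.getLast? = some f ∧ e ∈ Y ∧ f ∈ Y ∧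
      ¬ A e ∧ ¬ A' f ∧ D.length + 1 = 2 * t ∧ (D ++ pairVertices ws).Nodup := by
  obtain ⟨D₁, e₁, f₁, s₁, p₁, q₁, r₁, i₁, j₁, a₁, b₁⟩ := h₁
  obtain ⟨D₂, e₂, f₂, s₂, p₂, q₂, r₂, i₂, j₂, a₂, b₂⟩ := h₂
  obtain ⟨D₃, e₃, f₃, s₃, p₃, q₃, r₃, i₃, j₃, a₃, b₃⟩ := h₃
  have m₁ := (hx _ j₁).resolve_right b₁
  have m₂ := (hx _ i₂).resolve_right a₂
  have n₂ := (hx' _ j₂).resolve_right b₂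
  have n₃ := (hx' _ i₃).resolve_right a₃
  have s := s₂.join s₃ r₂ q₃ n₂ n₃
  refine ⟨D₁ ++ x :: (D₂ ++ x' :: D₃), e₁, f₃,
    s₁.join s r₁ (by simp [q₂]) m₁ m₂, by simp [q₁], ?_, i₁, j₃, a₁, b₃, ?_, ?_⟩
  · have : D₃ ≠ [] := s₃.ne_nil
    cases D₃ with
    | nil => contradiction
    | cons d D => simpa [List.getLast?_append, List.getLast?_cons] using r₃
  · have := h.count
    have l₁ := p₁.length_eq
    have l₂ := p₂.length_eq
    have l₃ := p₃.length_eq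
    simp at this ⊢
    omega
  · classical
    have h0 := h.nodup
    rw [List.nodup_iff_count_le_one] at h0 ⊢
    intro a
    have := h0 a
    have l₁ := p₁.count_eq a
    have l₂ := p₂.count_eq a
    have l₃ := p₃.count_eq a
    have l₄ := hp.count_eq a
    simp only [List.flatten_cons, List.flatten_nil, List.count_append, List.count_cons,
      List.count_nil] at this l₄ ⊢
    omega

/-- Three components, not all of them single vertices, are joined through `u` and `v` into one
path whose first end avoids `A` and whose last end avoids `A'`. -/
lemma BlueForest.exists_spanning_segment {A A' : V → Prop}
    (hM : ∀ x y z, M.Adj x y → M.Adj x z → y = z)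
    (h : BlueForest B M Y u v t L ws) (hL : L.length = 3) (ht : 4 ≤ t)
    (hu : ∀ y ∈ Y, B.Adj y u ∨ M.Adj u y) (hv : ∀ y ∈ Y, B.Adj y v ∨ M.Adj v y)
    (hA : ∀ x y z, A x → A y → A z → x = y ∨ x = z ∨ y = z)
    (hA' : ∀ x y z, A' x → A' y → A' z → x = y ∨ x = z ∨ y = z)
    (hAA' : ∀ y, A y → ¬ A' y)
    (huA : ∀ y, M.Adj u y → ¬ A y ∧ ¬ A' y) (hvA : ∀ y, M.Adj v y → ¬ A y ∧ ¬ A' y) :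
    ∃ D e f, IsSegment B Y D ∧ D.head? = some e ∧ D.getLast? = some f ∧ e ∈ Y ∧ f ∈ Y ∧
      ¬ A e ∧ ¬ A' f ∧ D.length + 1 = 2 * t ∧ (D ++ pairVertices ws).Nodup := by
  obtain ⟨C₁, C₂, C₃, hp, hlen⟩ : ∃ C₁ C₂ C₃, L.Perm [C₁, C₂, C₃] ∧ 2 ≤ C₁.length := by
    have hc := h.count
    match L, hL with
    | [C₁, C₂, C₃], _ =>
      simp at hc
      by_cases h1 : 2 ≤ C₁.length
      · exact ⟨C₁, C₂, C₃, List.Perm.refl _, h1⟩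
      by_cases h2 : 2 ≤ C₂.length
      · exact ⟨C₂, C₁, C₃, List.Perm.swap _ _ _, h2⟩
      · exact ⟨C₃, C₁, C₂, (List.perm_append_comm (l₁ := [C₁, C₂]) (l₂ := [C₃])), by omega⟩
  have hr := List.Perm.refl ws
  have g123 := h.perm hp hr
  have p132 : [C₁, C₂, C₃].Perm [C₁, C₃, C₂] := (List.Perm.swap _ _ _).cons _
  have p213 : [C₁, C₂, C₃].Perm [C₂, C₁, C₃] := List.Perm.swap _ _ _
  have p231 : [C₁, C₂, C₃].Perm [C₂, C₃, C₁] :=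
    List.perm_append_comm (l₁ := [C₁]) (l₂ := [C₂, C₃])
  have p312 : [C₁, C₂, C₃].Perm [C₃, C₁, C₂] :=
    List.perm_append_comm (l₁ := [C₁, C₂]) (l₂ := [C₃])
  have p321 : [C₁, C₂, C₃].Perm [C₃, C₂, C₁] := p231.trans (List.Perm.swap _ _ _)
  have huv : u ≠ v := by
    have := (List.nodup_append.1 h.nodup).2.1
    simpa using this
  have hMuv : ∀ y, M.Adj u y → ¬ M.Adj v y := fun y a b => huv (hM _ _ _ a.symm b.symm)
  have hMu := fun y z => hM u y z
  have hMv := fun y z => hM v y z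
  -- Each of the six orders of the components, with either order of the connectors, succeeds unless
  -- some component has both ends excluded on one of its two sides.
  have key : ∀ {D₁ D₂ D₃ : List V}, [C₁, C₂, C₃].Perm [D₁, D₂, D₃] →
      ((¬ BothEnds A D₁ ∧ ¬ BothEnds (M.Adj u) D₁ ∧ ¬ BothEnds (M.Adj u) D₂ ∧
        ¬ BothEnds (M.Adj v) D₂ ∧ ¬ BothEnds (M.Adj v) D₃ ∧ ¬ BothEnds A' D₃) ∨
      (¬ BothEnds A D₁ ∧ ¬ BothEnds (M.Adj v) D₁ ∧ ¬ BothEnds (M.Adj u) D₂ ∧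
        ¬ BothEnds (M.Adj v) D₂ ∧ ¬ BothEnds (M.Adj u) D₃ ∧ ¬ BothEnds A' D₃)) →
      ∃ D e f, IsSegment B Y D ∧ D.head? = some e ∧ D.getLast? = some f ∧ e ∈ Y ∧ f ∈ Y ∧
        ¬ A e ∧ ¬ A' f ∧ D.length + 1 = 2 * t ∧ (D ++ pairVertices ws).Nodup := by
    intro D₁ D₂ D₃ hD hc
    have g := g123.perm hD hr
    have s₁ := g.segment D₁ (by simp)
    have s₂ := g.segment D₂ (by simp)
    have s₃ := g.segment D₃ (by simp)
    rcases hc with ⟨c₁, c₂, c₃, c₄, c₅, c₆⟩ | ⟨c₁, c₂, c₃, c₄, c₅, c₆⟩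
    · exact g.join_three hu hv (List.Perm.refl _)
        (traversableAvoiding_of_not_bothEnds s₁ (fun y _ a b => (huA y b).1 a) c₁ c₂)
        (traversableAvoiding_of_not_bothEnds s₂ (fun y _ => hMuv y) c₃ c₄)
        (traversableAvoiding_of_not_bothEnds s₃ (fun y _ a => (hvA y a).2) c₅ c₆)
    · exact g.join_three hv hu (List.Perm.swap _ _ _)
        (traversableAvoiding_of_not_bothEnds s₁ (fun y _ a b => (hvA y b).1 a) c₁ c₂)
        (traversableAvoiding_of_not_bothEnds s₂ (fun y _ a b => hMuv y b a) c₄ c₃)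
        (traversableAvoiding_of_not_bothEnds s₃ (fun y _ a => (huA y a).2) c₅ c₆)
  have d : ∀ C ∈ [C₁, C₂, C₃], (BothEnds A C → ¬ BothEnds A' C) ∧
      (BothEnds (M.Adj u) C → ¬ BothEnds A C) ∧ (BothEnds (M.Adj u) C → ¬ BothEnds A' C) ∧
      (BothEnds (M.Adj v) C → ¬ BothEnds A C) ∧ (BothEnds (M.Adj v) C → ¬ BothEnds A' C) ∧
      (BothEnds (M.Adj u) C → ¬ BothEnds (M.Adj v) C) := by
    intro C hC
    have s := g123.segment C hC
    exact ⟨BothEnds.not_of_disjoint s fun y _ => hAA' y,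
      BothEnds.not_of_disjoint s fun y _ a => (huA y a).1,
      BothEnds.not_of_disjoint s fun y _ a => (huA y a).2,
      BothEnds.not_of_disjoint s fun y _ a => (hvA y a).1,
      BothEnds.not_of_disjoint s fun y _ a => (hvA y a).2,
      BothEnds.not_of_disjoint s fun y _ => hMuv y⟩
  have d₁ := d C₁ (by simp)
  have d₂ := d C₂ (by simp)
  have d₃ := d C₃ (by simp)
  have nu₁ := g123.not_bothEnds_of_two_le (C := C₁) (by simp) hlen hMu
  have nv₁ := g123.not_bothEnds_of_two_le (C := C₁) (by simp) hlen hMv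
  have nu₂₃ := (g123.perm p231 hr).not_bothEnds_of_subsingleton hMu
  have nv₂₃ := (g123.perm p231 hr).not_bothEnds_of_subsingleton hMv
  have nA₂ := g123.not_bothEnds_of_bothEnds hlen hA
  have nA₃ := (g123.perm p132 hr).not_bothEnds_of_bothEnds hlen hA
  have nA'₂ := g123.not_bothEnds_of_bothEnds hlen hA'
  have nA'₃ := (g123.perm p132 hr).not_bothEnds_of_bothEnds hlen hA'
  have k123 := key (List.Perm.refl _)
  have k132 := key p132
  have k213 := key p213
  have k231 := key p231
  have k312 := key p312
  have k321 := key p321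
  clear key d
  generalize (∃ D e f, IsSegment B Y D ∧ D.head? = some e ∧ D.getLast? = some f ∧ e ∈ Y ∧ f ∈ Y ∧
        ¬ A e ∧ ¬ A' f ∧ D.length + 1 = 2 * t ∧ (D ++ pairVertices ws).Nodup) = G at *
  generalize BothEnds A C₁ = a₁ at *
  generalize BothEnds A C₂ = a₂ at *
  generalize BothEnds A C₃ = a₃ at *
  generalize BothEnds A' C₁ = b₁ at *
  generalize BothEnds A' C₂ = b₂ at *
  generalize BothEnds A' C₃ = b₃ at *
  generalize BothEnds (M.Adj u) C₁ = u₁ at *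
  generalize BothEnds (M.Adj u) C₂ = u₂ at *
  generalize BothEnds (M.Adj u) C₃ = u₃ at *
  generalize BothEnds (M.Adj v) C₁ = v₁ at *
  generalize BothEnds (M.Adj v) C₂ = v₂ at *
  generalize BothEnds (M.Adj v) C₃ = v₃ at *
  -- The rest is propositional: the four kinds of exclusion are disjoint, `u` and `v` each exclude at
  -- most one component, a one-vertex one, and no kind excludes `C₁` together with another component.
  clear hA hA' hAA' huA hvA hu hv hM hMu hMv hMuv h g123 hp hr p132 p213 p231 p312 p321
  clear huv hL ht hlen
  grind (splits := 40)

end Orientation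

/-! ### Extending the joined path through the remaining windows -/

section Completion

variable {V : Type*} {B M : SimpleGraph V} {Y : Set V} {u v : V} {t : ℕ}
  {L : List (List V)} {ws : List (V × V)}

/-- A segment whose head is not `M`-adjacent to a window is extended through that window. -/
lemma exists_adj_window {w : V × V} {e : V} {D : List V}
    (hw : B.Adj e w.1 ∨ B.Adj e w.2 ∨ M.Adj w.1 e ∨ M.Adj w.2 e)
    (hD : D.IsChain B.Adj) (he : D.head? = some e) (hM : ¬ (M.Adj w.1 e ∨ M.Adj w.2 e)) :
    ∃ z, (z = w.1 ∨ z = w.2) ∧ (z :: D).IsChain B.Adj := by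
  obtain ⟨z, hz, hez⟩ : ∃ z, (z = w.1 ∨ z = w.2) ∧ B.Adj e z := by
    rcases hw with h | h | h
    · exact ⟨_, Or.inl rfl, h⟩
    · exact ⟨_, Or.inr rfl, h⟩
    · exact absurd h hM
  refine ⟨z, hz, hD.cons fun y hy => ?_⟩
  simp only [he, Option.mem_some_iff] at hy
  exact hy ▸ hez.symm

lemma two_of_three_eq (hM : ∀ x y z, M.Adj x y → M.Adj x z → y = z) (a b : V) :
    ∀ x y z, M.Adj a x ∨ M.Adj b x → M.Adj a y ∨ M.Adj b y → M.Adj a z ∨ M.Adj b z →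
      x = y ∨ x = z ∨ y = z := by
  have ha := hM a
  have hb := hM b
  intro x y z h₁ h₂ h₃
  rcases h₁ with h₁ | h₁ <;> rcases h₂ with h₂ | h₂ <;> rcases h₃ with h₃ | h₃ <;> grind

lemma BlueForest.hasPath_of_three (hM : ∀ x y z, M.Adj x y → M.Adj x z → y = z)
    (h : BlueForest B M Y u v t L ws) (hL : L.length = 3) (ht : 4 ≤ t)
    (hu : ∀ y ∈ Y, B.Adj y u ∨ M.Adj u y) (hv : ∀ y ∈ Y, B.Adj y v ∨ M.Adj v y) :
    HasPath B (2 * t - 1) := by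
  obtain ⟨D, -, -, s, -, -, -, -, -, -, hlen, hn⟩ :=
    h.exists_spanning_segment (A := fun _ => False) (A' := fun _ => False) hM hL ht hu hv
      (by simp) (by simp) (by simp) (by simp) (by simp)
  exact ⟨D, (List.nodup_append.1 hn).1, s.chain, by omega⟩

lemma BlueForest.hasPath_of_three_of_window (hM : ∀ x y z, M.Adj x y → M.Adj x z → y = z)
    {w : V × V} (h : BlueForest B M Y u v t L (w :: ws)) (hL : L.length = 3) (ht : 4 ≤ t)
    (hu : ∀ y ∈ Y, B.Adj y u ∨ M.Adj u y) (hv : ∀ y ∈ Y, B.Adj y v ∨ M.Adj v y) :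
    HasPath B (2 * t) := by
  have hMs : ∀ {x y z}, M.Adj x z → M.Adj y z → x = y := fun h₁ h₂ => hM _ _ _ h₁.symm h₂.symm
  have hnd := (List.nodup_append.1 h.nodup).2.2
  have hdisj : ∀ x ∈ [w.1, w.2], ∀ y ∈ [u, v], x ≠ y := fun x hx y hy =>
    hnd x (by rw [pairVertices_cons]; simp at hx ⊢; tauto) y hy
  obtain ⟨D, e, f, s, he, -, heY, -, hA, -, hlen, hn⟩ :=
    h.exists_spanning_segment (A := fun y => M.Adj w.1 y ∨ M.Adj w.2 y) (A' := fun _ => False)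
      hM hL ht hu hv (two_of_three_eq hM _ _) (by simp) (by simp)
      (fun y hy => ⟨by
        rintro (h | h)
        · exact hdisj w.1 (by simp) u (by simp) (hMs h hy)
        · exact hdisj w.2 (by simp) u (by simp) (hMs h hy), by simp⟩)
      (fun y hy => ⟨by
        rintro (h | h)
        · exact hdisj w.1 (by simp) v (by simp) (hMs h hy)
        · exact hdisj w.2 (by simp) v (by simp) (hMs h hy), by simp⟩)
  obtain ⟨z, hz, hc⟩ := exists_adj_window (h.window w (by simp) e heY) s.chain he hA
  refine ⟨z :: D, ?_, hc, by simp; omega⟩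
  rw [pairVertices_cons] at hn
  have hd := List.nodup_append.1 hn
  refine List.nodup_cons.2 ⟨fun hzD => hd.2.2 z hzD z ?_ rfl, hd.1⟩
  rcases hz with rfl | rfl <;> simp

lemma BlueForest.hasPath_of_three_of_two_windows
    (hM : ∀ x y z, M.Adj x y → M.Adj x z → y = z)
    {w w' : V × V} (h : BlueForest B M Y u v t L (w :: w' :: ws)) (hL : L.length = 3) (ht : 4 ≤ t)
    (hu : ∀ y ∈ Y, B.Adj y u ∨ M.Adj u y) (hv : ∀ y ∈ Y, B.Adj y v ∨ M.Adj v y) :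
    HasPath B (2 * t + 1) := by
  have hMs : ∀ {x y z}, M.Adj x z → M.Adj y z → x = y := fun h₁ h₂ => hM _ _ _ h₁.symm h₂.symm
  have hnd := (List.nodup_append.1 h.nodup).2.2
  have hdisj : ∀ x ∈ [w.1, w.2, w'.1, w'.2], ∀ y ∈ [u, v], x ≠ y := fun x hx y hy =>
    hnd x (by rw [pairVertices_cons, pairVertices_cons]; simp at hx ⊢; tauto) y hy
  have hww : ∀ x ∈ [w.1, w.2], ∀ y ∈ [w'.1, w'.2], x ≠ y := by
    have h1 := (List.nodup_append.1 (List.nodup_append.1 h.nodup).1).2.1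
    change ([w.1, w.2] ++ ([w'.1, w'.2] ++ pairVertices ws)).Nodup at h1
    exact fun x hx y hy => (List.nodup_append.1 h1).2.2 x hx y (List.mem_append_left _ hy)
  have huv : ∀ x ∈ [u, v], ∀ y, M.Adj x y →
      ¬ (M.Adj w.1 y ∨ M.Adj w.2 y) ∧ ¬ (M.Adj w'.1 y ∨ M.Adj w'.2 y) := by
    intro x hx y hy
    refine ⟨?_, ?_⟩ <;> rintro (h | h)
    · exact hdisj w.1 (by simp) x hx (hMs h hy)
    · exact hdisj w.2 (by simp) x hx (hMs h hy)
    · exact hdisj w'.1 (by simp) x hx (hMs h hy)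
    · exact hdisj w'.2 (by simp) x hx (hMs h hy)
  obtain ⟨D, e, f, s, he, hf, heY, hfY, hA, hA', hlen, hn⟩ :=
    h.exists_spanning_segment (A := fun y => M.Adj w.1 y ∨ M.Adj w.2 y)
      (A' := fun y => M.Adj w'.1 y ∨ M.Adj w'.2 y)
      hM hL ht hu hv (two_of_three_eq hM _ _) (two_of_three_eq hM _ _)
      (by
        rintro y (h | h) (h' | h')
        · exact hww w.1 (by simp) w'.1 (by simp) (hMs h h')
        · exact hww w.1 (by simp) w'.2 (by simp) (hMs h h')
        · exact hww w.2 (by simp) w'.1 (by simp) (hMs h h')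
        · exact hww w.2 (by simp) w'.2 (by simp) (hMs h h'))
      (huv u (by simp)) (huv v (by simp))
  obtain ⟨z, hz, hc⟩ := exists_adj_window (h.window w (by simp) e heY) s.chain he hA
  have hcr : (z :: D).reverse.IsChain B.Adj :=
    List.isChain_reverse.2 (hc.imp fun _ _ hab => hab.symm)
  have hfr : (z :: D).reverse.head? = some f := by
    rw [List.head?_reverse]
    have := s.ne_nil
    cases D with
    | nil => contradiction
    | cons d D => simpa using hf
  obtain ⟨z', hz', hc'⟩ := exists_adj_window (h.window w' (by simp) f hfY) hcr hfr hA'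
  refine ⟨z' :: (z :: D).reverse, ?_, hc', by simp; omega⟩
  rw [pairVertices_cons, pairVertices_cons] at hn
  have hd := List.nodup_append.1 hn
  have hzz : z' ≠ z := by
    rintro rfl
    exact hww z' (by simpa using hz) z' (by simpa using hz') rfl
  refine List.nodup_cons.2 ⟨fun hm => ?_, ?_⟩
  · rw [List.mem_reverse, List.mem_cons] at hm
    refine hm.elim hzz fun hzD => hd.2.2 z' hzD z' ?_ rfl
    rcases hz' with rfl | rfl <;> simp
  · rw [List.nodup_reverse]
    refine List.nodup_cons.2 ⟨fun hzD => hd.2.2 z hzD z ?_ rfl, hd.1⟩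
    rcases hz with rfl | rfl <;> simp

end Completion

/-! ### Windows along a longest path -/

/-- The list cut into consecutive pairs; a last entry without a partner is dropped. -/
def consecutivePairs {V : Type*} : List V → List (V × V)
  | a :: b :: l => (a, b) :: consecutivePairs l
  | [_] => []
  | [] => []

lemma length_consecutivePairs {V : Type*} :
    ∀ l : List V, (consecutivePairs l).length = l.length / 2
  | a :: b :: l => by
    rw [consecutivePairs, List.length_cons, length_consecutivePairs l]
    simp only [List.length_cons]
    omega
  | [_] => by simp [consecutivePairs]
  | [] => by simp [consecutivePairs]

lemma pairVertices_consecutivePairs_sublist {V : Type*} :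
    ∀ l : List V, (pairVertices (consecutivePairs l)).Sublist l
  | a :: b :: l => ((pairVertices_consecutivePairs_sublist l).cons_cons b).cons_cons a
  | [_] => by simp [consecutivePairs, pairVertices]
  | [] => by simp [consecutivePairs, pairVertices]

lemma infix_of_mem_consecutivePairs {V : Type*} {w : V × V} :
    ∀ l : List V, w ∈ consecutivePairs l → [w.1, w.2] <:+: l
  | a :: b :: l, h => by
    rw [consecutivePairs, List.mem_cons] at h
    rcases h with rfl | h
    · exact ⟨[], l, rfl⟩
    · exact (infix_of_mem_consecutivePairs l h).trans ⟨[a, b], [], by simp⟩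
  | [_], h => by simp [consecutivePairs] at h
  | [], h => by simp [consecutivePairs] at h

section LongestPath

variable {V : Type*} {B M R : SimpleGraph V} {u v : V} {mid mid' T : List V}

lemma not_adj_of_longest {X : List V} (hX : X.Nodup) (hc : X.IsChain R.Adj)
    (hmax : ∀ k, HasPath R k → k ≤ X.length) {x y : V} (hy : y ∉ X) (hx : X.head? = some x) :
    ¬ R.Adj y x := by
  intro h
  have := hmax _ ⟨y :: X, List.nodup_cons.2 ⟨hy, hX⟩, hc.cons fun z hz => by
    simp only [hx, Option.mem_some_iff] at hz
    exact hz ▸ h, rfl⟩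
  simp at this

lemma not_adj_both_of_longest {X : List V} (hX : X.Nodup) (hc : X.IsChain R.Adj)
    (hmax : ∀ k, HasPath R k → k ≤ X.length) {a b y : V} (hy : y ∉ X) (hab : [a, b] <:+: X) :
    ¬ (R.Adj y a ∧ R.Adj y b) := by
  classical
  rintro ⟨ha, hb⟩
  obtain ⟨s, r, rfl⟩ := hab
  have := hmax _ ⟨s ++ [a, y, b] ++ r, ?_, ?_, rfl⟩
  · simp at this
  · have hp : (s ++ [a, y, b] ++ r).Perm (y :: (s ++ [a, b] ++ r)) := by
      rw [List.perm_iff_count]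
      intro c
      simp only [List.count_append, List.count_cons, List.count_nil]
      omega
    exact hp.nodup_iff.2 (List.nodup_cons.2 ⟨hy, hX⟩)
  · simp only [List.append_assoc, List.cons_append, List.nil_append,
      List.isChain_append_cons_cons, List.isChain_cons_cons] at hc ⊢
    exact ⟨hc.1, ha.symm, hb, hc.2.2⟩

/-- The path with vertices `u`, `mid`, `v`, in this order, is a longest path of `R`. -/
structure IsLongestPath (R : SimpleGraph V) (u : V) (mid : List V) (v : V) : Prop where
  nodup : (u :: (mid ++ [v])).Nodup
  chain : (u :: (mid ++ [v])).IsChain R.Adj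
  longest : ∀ k, HasPath R k → k ≤ mid.length + 2

lemma IsLongestPath.not_adj_left (h : IsLongestPath R u mid v) {y : V}
    (hy : y ∉ u :: (mid ++ [v])) : ¬ R.Adj y u :=
  not_adj_of_longest h.nodup h.chain (by simpa using h.longest) hy rfl

lemma IsLongestPath.not_adj_right (h : IsLongestPath R u mid v) {y : V}
    (hy : y ∉ u :: (mid ++ [v])) : ¬ R.Adj y v :=
  not_adj_of_longest (X := (u :: (mid ++ [v])).reverse) (List.nodup_reverse.2 h.nodup)
    (List.isChain_reverse.2 (h.chain.imp fun _ _ hab => hab.symm)) (by simpa using h.longest)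
    (by rwa [List.mem_reverse]) (by simp)

lemma IsLongestPath.exists_of_hasPath {p : ℕ} (hp : HasPath R p) (hmax : ∀ k, HasPath R k → k ≤ p)
    (h2 : 2 ≤ p) : ∃ u mid v, IsLongestPath R u mid v ∧ mid.length + 2 = p := by
  obtain ⟨X, hn, hc, rfl⟩ := hp
  match X, h2 with
  | u :: X, h2 =>
    have hne : X ≠ [] := by rintro rfl; simp at h2
    have hX := List.dropLast_append_getLast hne
    have hlen : X.dropLast.length + 2 = (u :: X).length := by
      rw [List.length_dropLast]
      simp at h2 ⊢
      omega
    refine ⟨u, X.dropLast, X.getLast hne, ⟨by rwa [hX], by rwa [hX], ?_⟩, hlen⟩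
    rwa [hlen]

lemma IsLongestPath.adj_left (h : IsLongestPath R u mid v)
    (hcol : ∀ x y, x ≠ y → M.Adj x y ∨ R.Adj x y ∨ B.Adj x y) {y : V}
    (hy : y ∉ u :: (mid ++ [v])) : B.Adj y u ∨ M.Adj u y := by
  rcases hcol y u (by rintro rfl; simp at hy) with h' | h' | h'
  · exact Or.inr h'.symm
  · exact absurd h' (h.not_adj_left hy)
  · exact Or.inl h'

lemma IsLongestPath.adj_right (h : IsLongestPath R u mid v)
    (hcol : ∀ x y, x ≠ y → M.Adj x y ∨ R.Adj x y ∨ B.Adj x y) {y : V}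
    (hy : y ∉ u :: (mid ++ [v])) : B.Adj y v ∨ M.Adj v y := by
  rcases hcol y v (by rintro rfl; simp at hy) with h' | h' | h'
  · exact Or.inr h'.symm
  · exact absurd h' (h.not_adj_right hy)
  · exact Or.inl h'

/-- The forest of isolated vertices outside a longest path, with windows along the path. -/
lemma IsLongestPath.blueForest (h : IsLongestPath R u mid v)
    (hcol : ∀ x y, x ≠ y → M.Adj x y ∨ R.Adj x y ∨ B.Adj x y) (hTn : T.Nodup)
    (hT : ∀ y ∈ T, y ∉ u :: (mid ++ [v])) (hmid : mid' <:+: mid) :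
    BlueForest B M {y | y ∈ T} u v T.length (T.map fun y => [y]) (consecutivePairs mid') where
  segment C hC := by
    obtain ⟨y, hy, rfl⟩ := List.mem_map.1 hC
    exact isSegment_singleton hy
  nodup := by
    rw [← List.flatMap_def, List.flatMap_singleton']
    have hsub : (pairVertices (consecutivePairs mid') ++ [u, v]).Subperm (u :: (mid ++ [v])) := by
      have h1 : (pairVertices (consecutivePairs mid') ++ [u, v]).Sublist (mid ++ [u, v]) :=
        ((pairVertices_consecutivePairs_sublist mid').trans hmid.sublist).append_right _
      have h2 : (mid ++ [u, v]).Perm (u :: (mid ++ [v])) := List.perm_middle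
      exact h1.subperm.trans h2.subperm
    rw [List.append_assoc, List.nodup_append]
    refine ⟨hTn, ?_, fun a ha b hb hab => hT a ha (hab ▸ hsub.subset hb)⟩
    obtain ⟨l, hl, hls⟩ := hsub
    exact hl.nodup_iff.1 (h.nodup.sublist hls)
  window w hw y hy := by
    have hin : [w.1, w.2] <:+: u :: (mid ++ [v]) :=
      ((infix_of_mem_consecutivePairs mid' hw).trans hmid).trans ⟨[u], [v], by simp⟩
    have hyX := hT y hy
    have hne : ∀ x ∈ [w.1, w.2], y ≠ x := by
      rintro x hx rfl
      exact hyX (hin.subset hx)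
    have hR := not_adj_both_of_longest h.nodup h.chain (by simpa using h.longest) hyX hin
    have h₁ := hcol y w.1 (hne _ (by simp))
    have h₂ := hcol y w.2 (hne _ (by simp))
    rw [M.adj_comm w.1, M.adj_comm w.2]
    tauto
  count := by
    rw [← List.flatMap_def, List.flatMap_singleton', List.length_map]
    ring

lemma length_le_of_forall_exists_adj (hM : ∀ x y z, M.Adj x y → M.Adj x z → y = z) {l : List V}
    (hl : l.Nodup) (h : ∀ x ∈ l, ∃ y ∈ T, M.Adj x y) : l.length ≤ T.length := by
  classical
  choose! f hf hfM using h
  rw [← List.toFinset_card_of_nodup hl]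
  refine (Finset.card_le_card_of_injOn (t := T.toFinset) f ?_ ?_).trans T.toFinset_card_le
  · intro x hx
    simpa using hf x (by simpa using hx)
  · intro x hx y hy hxy
    have h1 := hfM x (by simpa using hx)
    have h2 := hfM y (by simpa using hy)
    exact hM (f x) _ _ h1.symm (hxy ▸ h2.symm)

lemma exists_adj_of_blocksTwo {w : V × V} (h : BlocksTwo M (T.map fun y => [y]) w) :
    (∃ y ∈ T, M.Adj w.1 y) ∧ ∃ y ∈ T, M.Adj w.2 y := by
  obtain ⟨e, f, he, hf, h₁, h₂⟩ := h
  simp only [List.mem_map, List.cons.injEq, and_true, exists_eq_right] at he hf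
  exact ⟨⟨e, he, h₁⟩, ⟨f, hf, h₂⟩⟩

/-- Outside a longest path of `R` on `p ≥ 2t - 1` vertices, any `t ≥ 4` vertices can be threaded
onto a `B`-path with `2t` vertices. -/
lemma IsLongestPath.hasPath_two_mul (h : IsLongestPath R u mid v)
    (hM : ∀ x y z, M.Adj x y → M.Adj x z → y = z)
    (hcol : ∀ x y, x ≠ y → M.Adj x y ∨ R.Adj x y ∨ B.Adj x y) (hTn : T.Nodup)
    (hT : ∀ y ∈ T, y ∉ u :: (mid ++ [v])) (h4 : 4 ≤ T.length)
    (hmid : 2 * T.length ≤ mid.length + 3) : HasPath B (2 * T.length) := by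
  have hu : ∀ y ∈ {y | y ∈ T}, B.Adj y u ∨ M.Adj u y := fun y hy => h.adj_left hcol (hT y hy)
  have hv : ∀ y ∈ {y | y ∈ T}, B.Adj y v ∨ M.Adj v y := fun y hy => h.adj_right hcol (hT y hy)
  suffices hs : ∃ L ws, BlueForest B M {y | y ∈ T} u v T.length L ws ∧ L.length = 3 ∧
      ws.length = 1 by
    obtain ⟨L, ws, hF, hL, hws⟩ := hs
    obtain ⟨w, rfl⟩ := List.length_eq_one_iff.1 hws
    exact hF.hasPath_of_three_of_window hM hL h4 hu hv
  rcases h4.eq_or_lt with h4 | h5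
  · -- Five interior vertices cannot all have `M`-neighbours among four vertices, so one of the
    -- two ways to cut two windows out of them leaves a window that does not block two vertices.
    match mid, h, hT, hmid with
    | a :: b :: c :: d :: e :: l, h, hT, hmid =>
      have hF₁ := h.blueForest hcol hTn hT (mid' := [a, b, c, d]) ⟨[], e :: l, rfl⟩
      have hF₂ := h.blueForest hcol hTn hT (mid' := [b, c, d, e]) ⟨[a], l, rfl⟩
      have hL : (T.map fun y => [y]).length = 4 := by simp [← h4]
      by_cases h1 : ∃ w ∈ consecutivePairs [a, b, c, d], ¬ BlocksTwo M (T.map fun y => [y]) w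
      · obtain ⟨L, ws, hF, hL, hw⟩ := hF₁.merge_of_four hM hL h1
        exact ⟨L, ws, hF, hL, by simp [consecutivePairs] at hw; omega⟩
      by_cases h2 : ∃ w ∈ consecutivePairs [b, c, d, e], ¬ BlocksTwo M (T.map fun y => [y]) w
      · obtain ⟨L, ws, hF, hL, hw⟩ := hF₂.merge_of_four hM hL h2
        exact ⟨L, ws, hF, hL, by simp [consecutivePairs] at hw; omega⟩
      exfalso
      push Not at h1 h2
      have hab := exists_adj_of_blocksTwo (h1 (a, b) (by simp [consecutivePairs]))
      have hcd := exists_adj_of_blocksTwo (h1 (c, d) (by simp [consecutivePairs]))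
      have hde := exists_adj_of_blocksTwo (h2 (d, e) (by simp [consecutivePairs]))
      have hnd : [a, b, c, d, e].Nodup :=
        h.nodup.sublist (List.IsInfix.sublist ⟨[u], l ++ [v], by simp⟩)
      have := length_le_of_forall_exists_adj hM (T := T) hnd (by
        intro x hx
        simp only [List.mem_cons, List.not_mem_nil, or_false] at hx
        rcases hx with rfl | rfl | rfl | rfl | rfl
        exacts [hab.1, hab.2, hcd.1, hcd.2, hde.2])
      simp at this
      omega
    | [], _, _, hmid | [_], _, _, hmid | [_, _], _, _, hmid | [_, _, _], _, _, hmid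
    | [_, _, _, _], _, _, hmid => simp at hmid; omega
  · have hF := h.blueForest hcol hTn hT (mid' := mid.take (2 * (T.length - 2)))
      (List.take_prefix _ _).isInfix
    exact hF.exists_three hM h5 le_rfl (k := T.length - 3) (by simp; omega)
      (by rw [length_consecutivePairs, List.length_take]; omega)

/-- If the longest path of `R` even has `p ≥ 2t` vertices, there is a `B`-path with `2t + 1`
vertices. -/
lemma IsLongestPath.hasPath_two_mul_add_one (h : IsLongestPath R u mid v)
    (hM : ∀ x y z, M.Adj x y → M.Adj x z → y = z)
    (hcol : ∀ x y, x ≠ y → M.Adj x y ∨ R.Adj x y ∨ B.Adj x y) (hTn : T.Nodup)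
    (hT : ∀ y ∈ T, y ∉ u :: (mid ++ [v])) (h4 : 4 ≤ T.length)
    (hmid : 2 * T.length ≤ mid.length + 2) : HasPath B (2 * T.length + 1) := by
  have hu : ∀ y ∈ {y | y ∈ T}, B.Adj y u ∨ M.Adj u y := fun y hy => h.adj_left hcol (hT y hy)
  have hv : ∀ y ∈ {y | y ∈ T}, B.Adj y v ∨ M.Adj v y := fun y hy => h.adj_right hcol (hT y hy)
  have hF := h.blueForest hcol hTn hT (mid' := mid.take (2 * (T.length - 1)))
    (List.take_prefix _ _).isInfix
  have hws : (consecutivePairs (mid.take (2 * (T.length - 1)))).length = T.length - 1 := by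
    rw [length_consecutivePairs, List.length_take]; omega
  suffices hs : ∃ L ws, BlueForest B M {y | y ∈ T} u v T.length L ws ∧ L.length = 3 ∧
      ws.length = 2 by
    obtain ⟨L, ws, hF, hL, hws⟩ := hs
    obtain ⟨w, w', rfl⟩ := List.length_eq_two.1 hws
    exact hF.hasPath_of_three_of_two_windows hM hL h4 hu hv
  rcases h4.eq_or_lt with h4 | h5
  · have hL : (T.map fun y => [y]).length = 4 := by simp [← h4]
    by_cases h1 : ∃ w ∈ consecutivePairs (mid.take (2 * (T.length - 1))),
        ¬ BlocksTwo M (T.map fun y => [y]) w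
    · obtain ⟨L, ws, hF, hL, hw⟩ := hF.merge_of_four hM hL h1
      exact ⟨L, ws, hF, hL, by omega⟩
    -- Otherwise the six vertices of the windows all have `M`-neighbours among four vertices.
    exfalso
    push Not at h1
    have := length_le_of_forall_exists_adj hM (T := T)
      (List.nodup_append.1 (List.nodup_append.1 hF.nodup).1).2.1 (by
        intro x hx
        obtain ⟨w, hw, hx⟩ := List.mem_flatMap.1 hx
        have := exists_adj_of_blocksTwo (h1 w hw)
        simp only [List.mem_cons, List.not_mem_nil, or_false] at hx
        rcases hx with rfl | rfl
        exacts [this.1, this.2])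
    rw [length_pairVertices, hws] at this
    omega
  · exact hF.exists_three hM h5 one_le_two (k := T.length - 3) (by simp; omega) (by omega)

/-- Five vertices outside a longest path of `R` with at least four vertices give a `B`-path with
seven vertices. -/
lemma IsLongestPath.hasPath_seven (h : IsLongestPath R u mid v)
    (hM : ∀ x y z, M.Adj x y → M.Adj x z → y = z)
    (hcol : ∀ x y, x ≠ y → M.Adj x y ∨ R.Adj x y ∨ B.Adj x y) (hTn : T.Nodup)
    (hT : ∀ y ∈ T, y ∉ u :: (mid ++ [v])) (h5 : T.length = 5) (hmid : 2 ≤ mid.length) :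
    HasPath B 7 := by
  have hu : ∀ y ∈ {y | y ∈ T}, B.Adj y u ∨ M.Adj u y := fun y hy => h.adj_left hcol (hT y hy)
  have hv : ∀ y ∈ {y | y ∈ T}, B.Adj y v ∨ M.Adj v y := fun y hy => h.adj_right hcol (hT y hy)
  match mid, h, hT, hmid with
  | a :: b :: l, h, hT, _ =>
    have hF := h.blueForest hcol hTn hT (mid' := [a, b]) ⟨[], l, rfl⟩
    obtain ⟨L, hF, hL⟩ := hF.merge_of_five_le hM (by simp [h5])
    have hL4 : L.length = 4 := by simp [h5] at hL; omega
    -- Four components with six vertices in all: one of them is a single vertex and is discarded.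
    obtain ⟨C, hC, hlen⟩ : ∃ C ∈ L, C.length = 1 := by
      by_contra! hs
      have hge : ∀ n ∈ L.map List.length, 2 ≤ n := by
        intro n hn
        obtain ⟨C, hC, rfl⟩ := List.mem_map.1 hn
        have h1 := hs C hC
        have h0 := List.length_pos_iff.2 (hF.segment C hC).ne_nil
        omega
      have h1 := List.card_nsmul_le_sum _ 2 hge
      have h2 := hF.count
      rw [List.length_flatten] at h2
      simp at h1
      omega
    classical
    have hp := List.perm_cons_erase hC
    have hF' := hF.perm hp (List.Perm.refl _)
    have hF4 : BlueForest B M {y | y ∈ T} u v 4 (L.erase C) [] :=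
      { segment := fun D hD => hF'.segment D (by simp [hD])
        nodup := by
          have := hF'.nodup
          rw [List.flatten_cons, List.append_assoc, List.append_assoc] at this
          rw [List.append_assoc]
          exact (List.nodup_append.1 this).2.1
        window := by simp
        count := by
          have := hF'.count
          rw [List.flatten_cons, List.length_append, List.length_cons] at this
          omega }
    exact hF4.hasPath_of_three hM (by rw [List.length_erase_of_mem hC]; omega) le_rfl hu hv

/-- Five vertices outside a longest path of `R` with at least two vertices give a `B`-path with
five vertices. -/
lemma IsLongestPath.hasPath_five (h : IsLongestPath R u mid v)
    (hM : ∀ x y z, M.Adj x y → M.Adj x z → y = z)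
    (hcol : ∀ x y, x ≠ y → M.Adj x y ∨ R.Adj x y ∨ B.Adj x y) (hTn : T.Nodup)
    (hT : ∀ y ∈ T, y ∉ u :: (mid ++ [v])) (h5 : T.length = 5) : HasPath B 5 := by
  classical
  -- At most one vertex of `T` is `M`-adjacent to `u`, and at most one to `v`.
  have hcard : ∀ x, (T.toFinset.filter fun y => M.Adj x y).card ≤ 1 := by
    intro x
    rw [Finset.card_le_one]
    intro a ha b hb
    exact hM x a b (Finset.mem_filter.1 ha).2 (Finset.mem_filter.1 hb).2
  have h3 : 2 < (T.toFinset \ ((T.toFinset.filter fun y => M.Adj u y) ∪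
      T.toFinset.filter fun y => M.Adj v y)).card := by
    have h1 := Finset.le_card_sdiff ((T.toFinset.filter fun y => M.Adj u y) ∪
      T.toFinset.filter fun y => M.Adj v y) T.toFinset
    have h2 := Finset.card_union_le (T.toFinset.filter fun y => M.Adj u y)
      (T.toFinset.filter fun y => M.Adj v y)
    have := hcard u
    have := hcard v
    rw [List.toFinset_card_of_nodup hTn] at h1
    omega
  obtain ⟨a, b, c, ha, hb, hc, hab, hac, hbc⟩ := Finset.two_lt_card_iff.1 h3
  have key : ∀ y ∈ T.toFinset \ ((T.toFinset.filter fun y => M.Adj u y) ∪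
      T.toFinset.filter fun y => M.Adj v y), B.Adj y u ∧ B.Adj y v ∧ y ≠ u ∧ y ≠ v := by
    intro y hy
    simp only [Finset.mem_sdiff, List.mem_toFinset, Finset.mem_union, Finset.mem_filter] at hy
    have hyX := hT y hy.1
    have h1 := h.adj_left hcol hyX
    have h2 := h.adj_right hcol hyX
    have h3 : B.Adj y u := by tauto
    have h4 : B.Adj y v := by tauto
    exact ⟨h3, h4, h3.ne, h4.ne⟩
  obtain ⟨a₁, a₂, a₃, a₄⟩ := key a ha
  obtain ⟨b₁, b₂, b₃, b₄⟩ := key b hb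
  obtain ⟨c₁, c₂, c₃, c₄⟩ := key c hc
  have huv : u ≠ v := by
    rintro rfl
    simpa using h.nodup
  refine ⟨[a, u, b, v, c], ?_, ?_, rfl⟩
  · simp only [List.nodup_cons, List.mem_cons, List.not_mem_nil, or_false, not_or,
      not_false_eq_true, List.nodup_nil, and_true]
    exact ⟨⟨a₃, hab, a₄, hac⟩, ⟨b₃.symm, huv, c₃.symm⟩, ⟨b₄, hbc⟩, c₄.symm⟩
  · simp only [List.isChain_cons_cons, List.isChain_singleton, and_true]
    exact ⟨a₁, b₁.symm, b₂, c₂.symm⟩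

end LongestPath

/-! ### The upper bound -/

section UpperBound

variable {V : Type*} [Fintype V] {B M R : SimpleGraph V}

/-- In a finite graph with enough vertices, `t` vertices can be chosen outside a given path. -/
lemma IsLongestPath.exists_outside {u v : V} {mid : List V} (h : IsLongestPath R u mid v) {t : ℕ}
    (ht : mid.length + 2 + t ≤ Fintype.card V) :
    ∃ T : List V, T.Nodup ∧ T.length = t ∧ ∀ y ∈ T, y ∉ u :: (mid ++ [v]) := by
  classical
  refine ⟨((u :: (mid ++ [v])).toFinsetᶜ).toList.take t,
    (Finset.nodup_toList _).sublist (List.take_sublist _ _), ?_, fun y hy => ?_⟩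
  · rw [List.length_take, Finset.length_toList, Finset.card_compl,
      List.toFinset_card_of_nodup h.nodup]
    simp
    omega
  · have := List.mem_of_mem_take hy
    rw [Finset.mem_toList, Finset.mem_compl, List.mem_toFinset] at this
    exact this

/-- If the longest paths of `R` have `p ≥ n - 1` vertices and at least `k = ⌊n / 2⌋` vertices lie
outside of one of them, then `B` has a path on `n` vertices. -/
lemma hasPath_of_longest {p k n : ℕ} (hM : ∀ x y z, M.Adj x y → M.Adj x z → y = z)
    (hcol : ∀ x y, x ≠ y → M.Adj x y ∨ R.Adj x y ∨ B.Adj x y)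
    (hp : HasPath R p) (hmax : ∀ j, HasPath R j → j ≤ p) (hk : 4 ≤ k) (hn : n ≤ 2 * k + 1)
    (hpn : n ≤ p + 1) (hkp : 2 * k ≤ p + 1) (hcard : p + k ≤ Fintype.card V) : HasPath B n := by
  obtain ⟨u, mid, v, h, hmid⟩ := IsLongestPath.exists_of_hasPath hp hmax (by omega)
  obtain ⟨T, hTn, rfl, hT⟩ := h.exists_outside (t := k) (by omega)
  rcases Nat.lt_or_ge (2 * T.length) n with hlt | hge
  · exact (h.hasPath_two_mul_add_one hM hcol hTn hT hk (by omega)).mono hn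
  · exact (h.hasPath_two_mul hM hcol hTn hT hk (by omega)).mono hge

/-- If the longest paths of `R` and `B` have `p ≥ q` vertices, then the whole graph has few
vertices compared to `p`. -/
lemma card_lt_of_longest {p q : ℕ} (hM : ∀ x y z, M.Adj x y → M.Adj x z → y = z)
    (hcol : ∀ x y, x ≠ y → M.Adj x y ∨ R.Adj x y ∨ B.Adj x y)
    (hp : HasPath R p) (hpmax : ∀ j, HasPath R j → j ≤ p) (hqmax : ∀ j, HasPath B j → j ≤ q)
    (hqp : q ≤ p) (h11 : 11 ≤ Fintype.card V) : Fintype.card V < p + (p + 1) / 2 := by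
  by_contra! hcard
  rcases Nat.lt_or_ge 6 p with h7 | h6
  · have := hqmax _ (hasPath_of_longest (k := (p + 1) / 2) (n := p + 1) hM hcol hp hpmax
      (by omega) (by omega) le_rfl (by omega) hcard)
    omega
  rcases Nat.lt_or_ge 1 p with h2 | h1
  · obtain ⟨u, mid, v, h, hmid⟩ := IsLongestPath.exists_of_hasPath hp hpmax h2
    obtain ⟨T, hTn, hTl, hT⟩ := h.exists_outside (t := 5) (by omega)
    rcases Nat.lt_or_ge 3 p with h4 | h3
    · have := hqmax _ (h.hasPath_seven hM hcol hTn hT hTl (by omega))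
      omega
    · have := hqmax _ (h.hasPath_five hM hcol hTn hT hTl)
      omega
  · -- `R` has no edges, so and `M`, a matching, is not complete: some `B`-edge exists.
    have hR : ∀ x y, ¬ R.Adj x y := fun x y hxy => by
      have := hpmax 2 ⟨[x, y], by simpa using hxy.ne, by simpa using hxy, rfl⟩
      omega
    obtain ⟨x, y, z, hxy, hxz, hyz⟩ := Fintype.two_lt_card_iff.1 (show 2 < Fintype.card V by omega)
    have hB : ∀ a b, ¬ B.Adj a b := fun a b hab => by
      have := hqmax 2 ⟨[a, b], by simpa using hab.ne, by simpa using hab, rfl⟩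
      omega
    have h1 := (hcol x y hxy).resolve_right (by simp [hR, hB])
    have h2 := (hcol x z hxz).resolve_right (by simp [hR, hB])
    exact hyz (hM _ _ _ h1 h2)

/-- If a matching `M` and two graphs `R`, `B` cover the complete graph on `m + ⌊n / 2⌋ - 1`
vertices, then `R` has a path on `m` vertices or `B` has a path on `n` vertices. -/
lemma hasPath_or_hasPath {m n : ℕ} (hM : ∀ x y z, M.Adj x y → M.Adj x z → y = z)
    (hcol : ∀ x y, x ≠ y → M.Adj x y ∨ R.Adj x y ∨ B.Adj x y) (hn : 8 ≤ n) (hmn : n ≤ m)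
    (hcard : Fintype.card V = m + n / 2 - 1) : HasPath R m ∨ HasPath B n := by
  by_contra! hcon
  obtain ⟨hRm, hBn⟩ := hcon
  have hcol' : ∀ x y, x ≠ y → M.Adj x y ∨ B.Adj x y ∨ R.Adj x y := fun x y hxy => by
    have := hcol x y hxy
    tauto
  obtain ⟨p, hp, hpmax⟩ := exists_longest_path R
  obtain ⟨q, hq, hqmax⟩ := exists_longest_path B
  have hpm : p < m := lt_of_not_ge fun h => hRm (hp.mono h)
  have hqn : q < n := lt_of_not_ge fun h => hBn (hq.mono h)
  rcases Nat.lt_or_ge p (n - 1) with hpn | hpn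
  · rcases Nat.lt_or_ge q (n - 1) with hqn' | hqn'
    · rcases le_total q p with hqp | hpq
      · have := card_lt_of_longest hM hcol hp hpmax hqmax hqp (by omega)
        omega
      · have := card_lt_of_longest hM hcol' hq hqmax hpmax hpq (by omega)
        omega
    · have := hpmax _ (hasPath_of_longest (k := n / 2) (n := n) hM hcol' hq hqmax
        (by omega) (by omega) (by omega) (by omega) (by omega))
      omega
  · exact hBn (hasPath_of_longest (k := n / 2) hM hcol hp hpmax
      (by omega) (by omega) (by omega) (by omega) (by omega))

end UpperBound

theorem theorem3p3 (m n : ℕ) (hn : 8 ≤ n) (hmn : n ≤ m) :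
    IsRamseyNumber (pathFamily ![3, n, m]) (m + n / 2 - 1) := by
  refine ⟨⟨by omega, fun C => ?_⟩, fun N hN => ?_⟩
  · by_contra hcon
    have h0 : ¬ HasPath (C.labelGraph 0) 3 := fun h => hcon ⟨0, h.pathGraph_isContained⟩
    have h1 : ¬ HasPath (C.labelGraph 1) n := fun h => hcon ⟨1, h.pathGraph_isContained⟩
    have h2 : ¬ HasPath (C.labelGraph 2) m := fun h => hcon ⟨2, h.pathGraph_isContained⟩
    have hM : ∀ x y z, (C.labelGraph 0).Adj x y → (C.labelGraph 0).Adj x z → y = z := by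
      intro x y z hy hz
      by_contra hyz
      exact h0 ⟨[y, x, z], by simp [hy.ne', hz.ne, hyz],
        by simp only [List.isChain_cons_cons, List.isChain_singleton, and_true]
           exact ⟨hy.symm, hz⟩, rfl⟩
    have hcol : ∀ x y, x ≠ y → (C.labelGraph 0).Adj x y ∨ (C.labelGraph 2).Adj x y ∨
        (C.labelGraph 1).Adj x y := by
      intro x y hxy
      simp only [TopEdgeLabeling.labelGraph_adj]
      generalize hc : EdgeLabeling.get C x y hxy = c
      fin_cases c
      · exact Or.inl ⟨hxy, hc⟩
      · exact Or.inr (Or.inr ⟨hxy, hc⟩)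
      · exact Or.inr (Or.inl ⟨hxy, hc⟩)
    rcases hasPath_or_hasPath hM hcol hn hmn (by simp) with h | h
    · exact h2 h
    · exact h1 h
  · by_contra hlt
    exact not_ramseyProperty_paths (by omega) hmn (not_le.1 hlt) hN.2
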